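/- Let $\mathfrak h$ and $\mathcal H$ be complex Hilbert spaces. Let $\mathsf E(\mathfrak h)$ be the set of pairs $(\Pi,\Theta)$ where $\Pi$ is an orthogonal projection in $\mathfrak h$ and $\Theta:D(\Theta)\subseteq\mathscr R(\Pi)\to\mathscr R(\Pi)$ is a (possibly unbounded) self-adjoint operator in the Hilbert space $\mathscr R(\Pi)$, the range of $\Pi$. A linear subspace $\Lambda\subseteq\mathfrak h\oplus\mathfrak h$ is called a self-adjoint relation if $\Lambda=\Lambda^*$, where $\Lambda^*=\{(\xi_1,\xi_2):(\zeta_1,\xi_2)=(\zeta_2,\xi_1)\text{ for all }(\zeta_1,\zeta_2)\in\Lambda\}$. **Part 1.** Every self-adjoint relation $\Lambda$ in $\mathfrak h\oplus\mathfrak h$ has the form $$\Lambda=\Lambda_{(\Pi,\Theta)}:=\{(\zeta_1,\zeta_2)\in\mathfrak h\oplus\mathfrak h:\ \zeta_1\in D(\Theta),\ \Theta\zeta_1=\Pi\zeta_2\}$$ for some $(\Pi,\Theta)\in\mathsf E(\mathfrak h)$. **Part 2.** Let $A:D(A)\subseteq\mathcal H\to\mathcal H$ be self-adjoint, let $\tau:D(A)\to\mathfrak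 h$ be linear, surjective, bounded with respect to the graph norm $(\|A\phi\|^2+\|\phi\|^2)^{1/2}$ on $D(A)$, with $\ker\tau$ dense in $\mathcal H$, and let $S$ be the restriction of $A$ to $\ker\tau$. For $z\in\mathbb C\setminus\mathbb R$ put $R(z)=(-A+z)^{-1}$ and $G(z)=(\tau R(\bar z))^*:\mathfrak h\to\mathcal H$, and let $G_*=\tfrac12(G(i)+G(-i))$. Every $\phi\in D(S^*)$ can be written uniquely as $\phi=\phi_*+G_*\zeta_\phi$ with $\phi_*\in D(A)$ and $\zeta_\phi\in\mathfrak h$; put $\hat\beta_1\phi:=\zeta_\phi$ and $\hat\beta_2\phi:=\tau\phi_*$. Then every self-adjoint extension of $S$ is the restriction of $S^*$ to $$\{\phi\in D(S^*):\ \hat\beta_1\phi\in D(\Theta),\ \Theta\hat\beta_1\phi=\Pi\hat\beta_2\phi\}$$ for some $(\Pi,\Theta)\in\mathsf E(\mathfrak h)$. -/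

import Mathlib

noncomputable section

open scoped ComplexConjugate

namespace SelfAdjExt

section Relations

variable {h : Type*} [NormedAddCommGroup h] [InnerProductSpace ℂ h] [CompleteSpace h]

/-- A linear relation `Λ ⊆ h ⊕ h` is self-adjoint if it equals its adjoint relation
`Λ^* = {(ξ₁, ξ₂) : ⟪ζ₂, ξ₁⟫ = ⟪ζ₁, ξ₂⟫ for all (ζ₁, ζ₂) ∈ Λ}`. -/
def IsSelfAdjointRelation (Λ : Submodule ℂ (h × h)) : Prop :=
  Λ.adjoint = Λ

theorem completeSpace_range {P : h →L[ℂ] h} (hP : IsStarProjection P) :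
    CompleteSpace (LinearMap.range (P : h →ₗ[ℂ] h)) :=
  (ContinuousLinearMap.IsIdempotentElem.isClosed_range hP.isIdempotentElem).completeSpace_coe

/-- The set `E(h)` of couples `(Π, Θ)`: `Π` is an orthogonal projection in `h` and `Θ` is a
(possibly unbounded) self-adjoint operator in the Hilbert space `range Π`. -/
structure ProjOpPair (h : Type*) [NormedAddCommGroup h] [InnerProductSpace ℂ h]
    [CompleteSpace h] where
  /-- the orthogonal projection `Π` -/
  proj : h →L[ℂ] h
  isStarProjection : IsStarProjection proj
  /-- the operator `Θ` in `range Π` -/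
  op : LinearMap.range (proj : h →ₗ[ℂ] h) →ₗ.[ℂ] LinearMap.range (proj : h →ₗ[ℂ] h)
  isSelfAdjoint :
    haveI := completeSpace_range isStarProjection
    IsSelfAdjoint op

/-- `Λ_(Π,Θ) = {(ζ₁, ζ₂) : ζ₁ ∈ D(Θ), Θ ζ₁ = Π ζ₂}`. -/
def ProjOpPair.relation (p : ProjOpPair h) : Submodule ℂ (h × h) where
  carrier := {ζ | ∃ x : p.op.domain, ((x : LinearMap.range (p.proj : h →ₗ[ℂ] h)) : h) = ζ.1 ∧
    (p.op x : h) = p.proj ζ.2}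
  zero_mem' := ⟨0, by simp⟩
  add_mem' := by
    rintro a b ⟨x, hx, hx'⟩ ⟨y, hy, hy'⟩
    exact ⟨x + y, by simp [hx, hy], by simp [LinearPMap.map_add, hx', hy']⟩
  smul_mem' := by
    rintro c a ⟨x, hx, hx'⟩
    exact ⟨c • x, by simp [hx], by simp [LinearPMap.map_smul, hx']⟩

end Relations

section Resolvent

variable {H : Type*} [NormedAddCommGroup H] [InnerProductSpace ℂ H]

/-- The resolvent set of an unbounded operator `A`: all `z` such that `-A + z : D(A) → H` is
bijective with bounded inverse. -/
def resolventSet (A : H →ₗ.[ℂ] H) : Set ℂ :=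
  {z | ∃ R : H →L[ℂ] H, (∀ ψ, ∃ φ : A.domain, (φ : H) = R ψ ∧ -A φ + z • (φ : H) = ψ) ∧
    ∀ φ : A.domain, R (-A φ + z • (φ : H)) = φ}

/-- The resolvent `R(z) = (-A + z)⁻¹` as a bounded operator. -/
def resolvent (A : H →ₗ.[ℂ] H) {z : ℂ} (hz : z ∈ resolventSet A) : H →L[ℂ] H :=
  hz.choose

variable {A : H →ₗ.[ℂ] H} {z : ℂ} (hz : z ∈ resolventSet A)

theorem resolvent_mem (ψ : H) : resolvent A hz ψ ∈ A.domain := by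
  obtain ⟨φ, hφ, -⟩ := hz.choose_spec.1 ψ
  have : resolvent A hz ψ = φ := hφ.symm
  exact this ▸ φ.2

/-- The resolvent as a linear map `H → D(A)`. -/
def resolventDom : H →ₗ[ℂ] A.domain :=
  (resolvent A hz : H →ₗ[ℂ] H).codRestrict A.domain (resolvent_mem hz)

theorem resolventDom_spec (ψ : H) :
    -A (resolventDom hz ψ) + z • (resolventDom hz ψ : H) = ψ := by
  obtain ⟨φ, hφ, h2⟩ := hz.choose_spec.1 ψ
  have : resolventDom hz ψ = φ := Subtype.ext hφ.symm
  rw [this]; exact h2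

theorem resolventDom_apply (φ : A.domain) :
    resolventDom hz (-A φ + z • (φ : H)) = φ :=
  Subtype.ext (hz.choose_spec.2 φ)

/-- Non-real numbers belong to the resolvent set of a self-adjoint operator. -/
theorem mem_resolventSet_of_im_ne_zero [CompleteSpace H] (hA : IsSelfAdjoint A)
    (hz : z.im ≠ 0) : z ∈ resolventSet A := by
  have hdense := hA.dense_domain
  have hfa : A.IsFormalAdjoint A := by
    have := LinearPMap.adjoint_isFormalAdjoint hdense
    rwa [LinearPMap.isSelfAdjoint_def.mp hA] at this
  have hbound : ∀ φ : A.domain, |z.im| * ‖(φ : H)‖ ≤ ‖-A φ + z • (φ : H)‖ := by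
    intro φ
    rcases eq_or_ne (φ : H) 0 with h0 | h0
    · simp [h0]
    have hpos : 0 < ‖(φ : H)‖ := norm_pos_iff.mpr h0
    have him : (inner ℂ (φ : H) (A φ)).im = 0 := by
      have h1 := hfa φ φ
      have h2 := inner_conj_symm (𝕜 := ℂ) (φ : H) (A φ)
      rw [h1] at h2
      exact Complex.conj_eq_iff_im.mp h2
    have h3 : (inner ℂ (φ : H) (-A φ + z • (φ : H))).im = z.im * ‖(φ : H)‖ ^ 2 := by
      rw [inner_add_right, inner_neg_right, inner_smul_right, inner_self_eq_norm_sq_to_K]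
      simp [him, ← Complex.ofReal_pow]
    have h4 : |z.im * ‖(φ : H)‖ ^ 2| ≤ ‖(φ : H)‖ * ‖-A φ + z • (φ : H)‖ := by
      rw [← h3]
      exact (Complex.abs_im_le_norm _).trans (norm_inner_le_norm _ _)
    rw [abs_mul, abs_of_nonneg (sq_nonneg ‖(φ : H)‖)] at h4
    refine le_of_mul_le_mul_left ?_ hpos
    linarith [h4, (by ring : ‖(φ : H)‖ * (|z.im| * ‖(φ : H)‖) = |z.im| * ‖(φ : H)‖ ^ 2)]
  have hzpos : 0 < |z.im| := abs_pos.mpr hz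
  have hclosed : IsClosed (A.graph : Set (H × H)) := hA.isClosed
  have : CompleteSpace A.graph := hclosed.completeSpace_coe
  let g : A.graph →L[ℂ] H :=
    (-(ContinuousLinearMap.snd ℂ H H) + z • ContinuousLinearMap.fst ℂ H H).comp
      A.graph.subtypeL
  have hg : ∀ x : A.graph, ∃ φ : A.domain, (φ : H) = (x : H × H).1 ∧ A φ = (x : H × H).2 ∧
      g x = -A φ + z • (φ : H) := by
    intro x
    obtain ⟨φ, h1, h2⟩ := (LinearPMap.mem_graph_iff A).mp x.2
    refine ⟨φ, h1, h2, ?_⟩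
    simp [g, h1, h2]
  let C : ℝ := 1 + (|z.im|⁻¹) * (1 + ‖z‖)
  have hanti : ∀ x : A.graph, ‖x‖ ≤ C * ‖g x‖ := by
    intro x
    obtain ⟨φ, h1, h2, h3⟩ := hg x
    have hb := hbound φ
    rw [← h3] at hb
    have hb' : ‖(φ : H)‖ ≤ |z.im|⁻¹ * ‖g x‖ := by
      rw [inv_mul_eq_div, le_div_iff₀ hzpos]; linarith
    have hA' : ‖A φ‖ ≤ ‖g x‖ + ‖z‖ * ‖(φ : H)‖ := by
      have : A φ = z • (φ : H) - g x := by rw [h3]; abel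
      rw [this]
      calc _ ≤ ‖z • (φ : H)‖ + ‖g x‖ := norm_sub_le _ _
        _ = _ := by rw [norm_smul]; ring
    have hn : ‖x‖ = max ‖(φ : H)‖ ‖A φ‖ := by
      rw [h1, h2]; rfl
    have hC : C * ‖g x‖ = ‖g x‖ + |z.im|⁻¹ * ‖g x‖ + ‖z‖ * (|z.im|⁻¹ * ‖g x‖) := by
      simp only [C]; ring
    have h5 : ‖z‖ * ‖(φ : H)‖ ≤ ‖z‖ * (|z.im|⁻¹ * ‖g x‖) := by gcongr
    have h6 : 0 ≤ ‖z‖ * ‖(φ : H)‖ := by positivity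
    have h7 : 0 ≤ |z.im|⁻¹ * ‖g x‖ := by positivity
    rw [hn, hC]
    exact max_le (by linarith [norm_nonneg (g x)]) (by linarith)
  have hinj : Function.Injective g := by
    refine (injective_iff_map_eq_zero g).mpr fun x hx => ?_
    have := hanti x
    rw [hx, norm_zero, mul_zero] at this
    exact norm_le_zero_iff.mp this
  have hrc : IsClosed (Set.range g) := by
    have hC0 : 0 ≤ C := by simp only [C]; positivity
    have : AntilipschitzWith ⟨C, hC0⟩ g :=
      AddMonoidHomClass.antilipschitz_of_bound g hanti
    exact this.isClosed_range g.uniformContinuous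
  have hsurj : LinearMap.range (g : A.graph →ₗ[ℂ] H) = ⊤ := by
    have hc : IsClosed ((LinearMap.range (g : A.graph →ₗ[ℂ] H) : Submodule ℂ H) : Set H) := hrc
    have : CompleteSpace (LinearMap.range (g : A.graph →ₗ[ℂ] H)) := hc.completeSpace_coe
    rw [← Submodule.orthogonal_eq_bot_iff, Submodule.eq_bot_iff]
    intro u hu
    have hu' : ∀ φ : A.domain, inner ℂ (conj z • u) (φ : H) = inner ℂ u (A φ) := by
      intro φ
      have hmem : g ⟨((φ : H), A φ), A.mem_graph φ⟩ ∈
          LinearMap.range (g : A.graph →ₗ[ℂ] H) := ⟨_, rfl⟩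
      have := (Submodule.mem_orthogonal' _ _).mp hu _ hmem
      simp only [g, ContinuousLinearMap.comp_apply, Submodule.subtypeL_apply,
        add_apply, neg_apply,
        smul_apply, ContinuousLinearMap.coe_fst',
        ContinuousLinearMap.coe_snd', inner_add_right, inner_neg_right, inner_smul_right] at this
      rw [inner_smul_left, Complex.conj_conj]
      linear_combination this
    have hud : u ∈ A.domain := by
      rw [← LinearPMap.isSelfAdjoint_def.mp hA]
      exact LinearPMap.mem_adjoint_domain_of_exists u ⟨_, hu'⟩
    have hAu : A ⟨u, hud⟩ = conj z • u := by
      refine hdense.eq_of_inner_left ℂ fun v hv => ?_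
      rw [hfa ⟨u, hud⟩ ⟨v, hv⟩, ← hu' ⟨v, hv⟩]
    have him : (inner ℂ u (A ⟨u, hud⟩)).im = 0 := by
      have h1 := hfa ⟨u, hud⟩ ⟨u, hud⟩
      have h2 := inner_conj_symm (𝕜 := ℂ) u (A ⟨u, hud⟩)
      rw [h1] at h2
      exact Complex.conj_eq_iff_im.mp h2
    rw [hAu, inner_smul_right, inner_self_eq_norm_sq_to_K] at him
    simp [← Complex.ofReal_pow, hz] at him
    exact him
  let e := ContinuousLinearEquiv.ofBijective g (LinearMap.ker_eq_bot.mpr hinj) hsurj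
  refine ⟨(ContinuousLinearMap.fst ℂ H H).comp (A.graph.subtypeL.comp
    (e.symm : H →L[ℂ] A.graph)), fun ψ => ?_, fun φ => ?_⟩
  · obtain ⟨φ, h1, h2, h3⟩ := hg (e.symm ψ)
    exact ⟨φ, h1, h3.symm.trans (e.apply_symm_apply ψ)⟩
  · have h1 : -A φ + z • (φ : H) = e ⟨((φ : H), A φ), A.mem_graph φ⟩ := by
      change _ = g _
      simp [g]
    rw [h1]
    simp

end Resolvent

/-- The standing data: a self-adjoint operator `A` in the Hilbert space `H` and a linear map
`τ` from `D(A)` onto the Hilbert space `h`, bounded for the graph norm of `A` on `D(A)`, whose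
kernel is dense in `H`. -/
structure TraceData (H h : Type*) [NormedAddCommGroup H] [InnerProductSpace ℂ H]
    [CompleteSpace H] [NormedAddCommGroup h] [InnerProductSpace ℂ h] [CompleteSpace h] where
  A : H →ₗ.[ℂ] H
  isSelfAdjoint : IsSelfAdjoint A
  τ : A.domain →ₗ[ℂ] h
  bounded : ∃ C : ℝ, ∀ φ : A.domain, ‖τ φ‖ ≤ C * √(‖A φ‖ ^ 2 + ‖(φ : H)‖ ^ 2)
  surjective : Function.Surjective τ
  dense_ker : Dense (((LinearMap.ker τ).map A.domain.subtype : Submodule ℂ H) : Set H)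

namespace TraceData

variable {H h : Type*} [NormedAddCommGroup H] [InnerProductSpace ℂ H] [CompleteSpace H]
  [NormedAddCommGroup h] [InnerProductSpace ℂ h] [CompleteSpace h] (D : TraceData H h)

/-- The symmetric operator `S`: the restriction of `A` to the kernel of `τ`. -/
def S : H →ₗ.[ℂ] H :=
  D.A.domRestrict ((LinearMap.ker D.τ).map D.A.domain.subtype)

/-- The bounded operator `τ R(z) : H → h`. -/
def traceResolvent {z : ℂ} (hz : z ∈ resolventSet D.A) : H →L[ℂ] h where
  toLinearMap := D.τ ∘ₗ resolventDom hz
  cont := by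
    obtain ⟨C, hC⟩ := D.bounded
    refine AddMonoidHomClass.continuous_of_bound (D.τ ∘ₗ resolventDom hz)
      (|C| * (1 + ‖z‖ * ‖resolvent D.A hz‖ + ‖resolvent D.A hz‖)) fun ψ => ?_
    have h1 : ‖(resolventDom hz ψ : H)‖ ≤ ‖resolvent D.A hz‖ * ‖ψ‖ :=
      (resolvent D.A hz).le_opNorm ψ
    have h2 : ‖D.A (resolventDom hz ψ)‖ ≤ ‖ψ‖ + ‖z‖ * ‖(resolventDom hz ψ : H)‖ := by
      have h := resolventDom_spec hz ψ
      have h' : D.A (resolventDom hz ψ) = z • (resolventDom hz ψ : H) - ψ := by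
        rw [eq_sub_iff_add_eq, ← sub_eq_zero]
        rw [← sub_eq_zero] at h
        rw [← neg_eq_zero, ← h]; abel
      rw [h']
      calc _ ≤ ‖z • (resolventDom hz ψ : H)‖ + ‖ψ‖ := norm_sub_le _ _
        _ = _ := by rw [norm_smul]; ring
    have h3 : √(‖D.A (resolventDom hz ψ)‖ ^ 2 + ‖(resolventDom hz ψ : H)‖ ^ 2) ≤
        ‖D.A (resolventDom hz ψ)‖ + ‖(resolventDom hz ψ : H)‖ := by
      refine Real.sqrt_le_iff.mpr ⟨by positivity, ?_⟩
      nlinarith [norm_nonneg (D.A (resolventDom hz ψ)), norm_nonneg (resolventDom hz ψ : H)]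
    have h4 : ‖z‖ * ‖(resolventDom hz ψ : H)‖ ≤ ‖z‖ * (‖resolvent D.A hz‖ * ‖ψ‖) := by gcongr
    calc ‖D.τ (resolventDom hz ψ)‖
        ≤ C * √(‖D.A (resolventDom hz ψ)‖ ^ 2 + ‖(resolventDom hz ψ : H)‖ ^ 2) := hC _
      _ ≤ |C| * √(‖D.A (resolventDom hz ψ)‖ ^ 2 + ‖(resolventDom hz ψ : H)‖ ^ 2) := by
          gcongr; exact le_abs_self C
      _ ≤ |C| * ((1 + ‖z‖ * ‖resolvent D.A hz‖ + ‖resolvent D.A hz‖) * ‖ψ‖) := by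
          gcongr; linarith
      _ = _ := by ring

/-- The non-real numbers belong to the resolvent set of `A`, in the form in which the definition
of `G(z)` uses it. -/
theorem conj_mem {z : ℂ} (hz : z.im ≠ 0) : conj z ∈ resolventSet D.A :=
  mem_resolventSet_of_im_ne_zero D.isSelfAdjoint (by simpa using hz)

/-- `G(z) = (τ R(z̄))^* : h → H` for non-real `z`. -/
def G {z : ℂ} (hz : z.im ≠ 0) : h →L[ℂ] H :=
  ContinuousLinearMap.adjoint (D.traceResolvent (D.conj_mem hz))

theorem I_im_ne : Complex.I.im ≠ 0 := by simp

theorem neg_I_im_ne : (-Complex.I).im ≠ 0 := by simp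

/-- `G_* = (G(-i) + G(i)) / 2`. -/
def Gstar : h →L[ℂ] H :=
  (2⁻¹ : ℂ) • (D.G neg_I_im_ne + D.G I_im_ne)

theorem dense_S : Dense (D.S.domain : Set H) := by
  have : D.S.domain = (LinearMap.ker D.τ).map D.A.domain.subtype := by
    refine inf_eq_left.mpr ?_
    rintro _ ⟨x, -, rfl⟩
    exact x.2
  rw [this]; exact D.dense_ker

theorem mem_S {φ : D.A.domain} (hφ : D.τ φ = 0) :
    ∃ y : D.S.domain, (y : H) = φ ∧ D.S y = D.A φ :=
  ⟨⟨φ, ⟨⟨φ, hφ, rfl⟩, φ.2⟩⟩, rfl, LinearPMap.domRestrict_apply rfl⟩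

theorem of_mem_S (y : D.S.domain) :
    ∃ φ : D.A.domain, D.τ φ = 0 ∧ (φ : H) = y ∧ D.A φ = D.S y := by
  obtain ⟨⟨φ, h1, h2⟩, h3⟩ := y.2
  exact ⟨φ, h1, h2, (LinearPMap.domRestrict_apply h2.symm).symm⟩

theorem formalAdjoint_A : D.A.IsFormalAdjoint D.A := by
  have := LinearPMap.adjoint_isFormalAdjoint D.isSelfAdjoint.dense_domain
  rwa [LinearPMap.isSelfAdjoint_def.mp D.isSelfAdjoint] at this

theorem A_le_adjoint : D.A ≤ D.S.adjoint := by
  refine LinearPMap.IsFormalAdjoint.le_adjoint D.dense_S fun y φ => ?_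
  obtain ⟨φ', -, h2, h3⟩ := D.of_mem_S y
  rw [← h3, ← h2]
  exact D.formalAdjoint_A φ' φ

theorem adjoint_A (φ : D.A.domain) :
    ∃ x : D.S.adjoint.domain, (x : H) = φ ∧ D.S.adjoint x = D.A φ :=
  ⟨⟨φ, D.A_le_adjoint.1 φ.2⟩, rfl, (D.A_le_adjoint.2 rfl).symm⟩

theorem inner_G {z : ℂ} (hz : z.im ≠ 0) (ζ : h) (φ : D.A.domain) :
    inner ℂ (D.G hz ζ) (-D.A φ + conj z • (φ : H)) = inner ℂ ζ (D.τ φ) := by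
  rw [G, ContinuousLinearMap.adjoint_inner_left]
  change inner ℂ ζ (D.τ (resolventDom _ _)) = _
  rw [resolventDom_apply]

theorem inner_G' {z : ℂ} (hz : z.im ≠ 0) (ζ : h) (φ : D.A.domain) :
    inner ℂ (D.G hz ζ) (D.A φ) =
      conj z * inner ℂ (D.G hz ζ) (φ : H) - inner ℂ ζ (D.τ φ) := by
  have := D.inner_G hz ζ φ
  rw [inner_add_right, inner_neg_right, inner_smul_right] at this
  linear_combination -this

theorem adjoint_G {z : ℂ} (hz : z.im ≠ 0) (ζ : h) :
    ∃ x : D.S.adjoint.domain, (x : H) = D.G hz ζ ∧ D.S.adjoint x = z • D.G hz ζ := by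
  have key : ∀ y : D.S.domain,
      inner ℂ (z • D.G hz ζ) (y : H) = inner ℂ (D.G hz ζ) (D.S y) := by
    intro y
    obtain ⟨φ, h1, h2, h3⟩ := D.of_mem_S y
    rw [← h2, ← h3, inner_G', h1, inner_smul_left]
    simp
  exact ⟨⟨D.G hz ζ, LinearPMap.mem_adjoint_domain_of_exists _ ⟨_, key⟩⟩, rfl,
    LinearPMap.adjoint_apply_eq D.dense_S _ key⟩

theorem G_diff_mem (ζ : h) : D.G I_im_ne ζ - D.G neg_I_im_ne ζ ∈ D.A.domain := by
  rw [← LinearPMap.isSelfAdjoint_def.mp D.isSelfAdjoint]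
  refine LinearPMap.mem_adjoint_domain_of_exists _
    ⟨Complex.I • (D.G I_im_ne ζ + D.G neg_I_im_ne ζ), fun φ => ?_⟩
  rw [inner_sub_left, inner_G', inner_G', inner_smul_left, inner_add_left]
  simp only [map_neg, Complex.conj_I]
  ring

theorem Gstar_eq (ζ : h) :
    ∃ u : D.A.domain, D.G I_im_ne ζ = (u : H) + D.Gstar ζ := by
  refine ⟨⟨_, D.A.domain.smul_mem (2⁻¹ : ℂ) (D.G_diff_mem ζ)⟩, ?_⟩
  simp only [Gstar, smul_apply, add_apply]
  module

theorem exists_G_of_eigen (x : D.S.adjoint.domain)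
    (hx : D.S.adjoint x = Complex.I • (x : H)) : ∃ ζ : h, D.G I_im_ne ζ = x := by
  have hm := D.conj_mem I_im_ne
  set T := D.traceResolvent hm with hT
  have hTs : Function.Surjective T := by
    intro ζ
    obtain ⟨φ, rfl⟩ := D.surjective ζ
    refine ⟨-D.A φ + conj Complex.I • (φ : H), ?_⟩
    change D.τ (resolventDom hm _) = _
    rw [resolventDom_apply]
  have hker : ∀ ψ, T ψ = 0 → inner ℂ (x : H) ψ = 0 := by
    intro ψ hψ
    obtain ⟨y, h1, h2⟩ := D.mem_S (φ := resolventDom hm ψ) hψ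
    have h3 := resolventDom_spec hm ψ
    have h4 := LinearPMap.adjoint_isFormalAdjoint D.dense_S x y
    rw [hx, inner_smul_left, h1, h2] at h4
    rw [← h3, inner_add_right, inner_neg_right, inner_smul_right, ← h4]
    ring
  obtain ⟨C, -, hC⟩ := T.exists_preimage_norm_le hTs
  choose f hf hfC using hC
  have hfT : ∀ ψ, inner ℂ (x : H) (f (T ψ)) = inner ℂ (x : H) ψ := by
    intro ψ
    rw [← sub_eq_zero, ← inner_sub_right]
    exact hker _ (by rw [map_sub, hf, sub_self])
  let l : h →ₗ[ℂ] ℂ :=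
    { toFun := fun ζ => inner ℂ (x : H) (f ζ)
      map_add' := fun a b => by
        have := hfT (f a + f b)
        rwa [map_add, hf, hf, inner_add_right] at this
      map_smul' := fun c a => by
        have := hfT (c • f a)
        rwa [map_smul, hf, inner_smul_right] at this }
  let L : StrongDual ℂ h := l.mkContinuous (‖(x : H)‖ * C) fun ζ => by
    calc ‖inner ℂ (x : H) (f ζ)‖ ≤ ‖(x : H)‖ * ‖f ζ‖ := norm_inner_le_norm _ _
      _ ≤ ‖(x : H)‖ * (C * ‖ζ‖) := by gcongr; exact hfC ζ
      _ = _ := by ring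
  refine ⟨(InnerProductSpace.toDual ℂ h).symm L, ext_inner_right ℂ fun ψ => ?_⟩
  rw [G, ContinuousLinearMap.adjoint_inner_left, InnerProductSpace.toDual_symm_apply]
  exact hfT ψ

/-- The map `(φ_*, ζ) ↦ φ_* + G_* ζ`. -/
def decompMap : D.A.domain × h →ₗ[ℂ] H :=
  D.A.domain.subtype.coprod (D.Gstar : h →ₗ[ℂ] H)

theorem decompMap_apply (p : D.A.domain × h) :
    D.decompMap p = (p.1 : H) + D.Gstar p.2 := rfl

theorem decompMap_injective : Function.Injective D.decompMap := by
  refine (injective_iff_map_eq_zero D.decompMap).mpr ?_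
  rintro ⟨φ, ζ⟩ hp
  rw [decompMap_apply] at hp
  obtain ⟨u, hu⟩ := D.Gstar_eq ζ
  have h1 : D.G I_im_ne ζ = ((u - φ : D.A.domain) : H) := by
    rw [hu, eq_neg_of_add_eq_zero_right hp]
    simp [sub_eq_add_neg]
  obtain ⟨x, hx1, hx2⟩ := D.adjoint_G I_im_ne ζ
  obtain ⟨y, hy1, hy2⟩ := D.adjoint_A (u - φ)
  have hxy : x = y := Subtype.ext (by rw [hx1, hy1, h1])
  have h2 : D.A (u - φ) = Complex.I • ((u - φ : D.A.domain) : H) := by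
    rw [← hy2, ← hxy, hx2, h1]
  have hI := mem_resolventSet_of_im_ne_zero D.isSelfAdjoint I_im_ne
  have h3 : u - φ = 0 := by
    rw [← resolventDom_apply hI (u - φ), h2]
    simp
  have hG : D.G I_im_ne ζ = 0 := by rw [h1, h3]; rfl
  have hζ : ζ = 0 := by
    refine ext_inner_right ℂ fun ξ => ?_
    obtain ⟨χ, rfl⟩ := D.surjective ξ
    rw [← D.inner_G I_im_ne, hG, inner_zero_left, inner_zero_left]
  subst hζ
  simpa using hp

theorem range_decompMap : LinearMap.range D.decompMap = D.S.adjoint.domain := by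
  apply le_antisymm
  · rintro _ ⟨p, rfl⟩
    rw [decompMap_apply]
    refine add_mem (D.A_le_adjoint.1 p.1.2) ?_
    obtain ⟨x, hx, -⟩ := D.adjoint_G I_im_ne p.2
    obtain ⟨y, hy, -⟩ := D.adjoint_G neg_I_im_ne p.2
    exact Submodule.smul_mem _ _ (add_mem (hy ▸ y.2) (hx ▸ x.2))
  · intro φ hφ
    have hI := mem_resolventSet_of_im_ne_zero D.isSelfAdjoint I_im_ne
    let x : D.S.adjoint.domain := ⟨φ, hφ⟩
    let u := resolventDom hI (-D.S.adjoint x + Complex.I • φ)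
    have hu := resolventDom_spec hI (-D.S.adjoint x + Complex.I • φ)
    obtain ⟨y, hy1, hy2⟩ := D.adjoint_A u
    obtain ⟨ζ, hζ⟩ := D.exists_G_of_eigen (x - y) (by
      rw [LinearPMap.map_sub, hy2, Submodule.coe_sub, hy1, smul_sub]
      change -D.A u + Complex.I • (u : H) = _ at hu
      rw [← sub_eq_zero] at hu
      rw [← sub_eq_zero, ← hu]
      simp only [x]
      abel)
    obtain ⟨v, hv⟩ := D.Gstar_eq ζ
    refine ⟨(u + v, ζ), ?_⟩
    rw [decompMap_apply]
    rw [hv, Submodule.coe_sub, hy1] at hζ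
    simp only [Submodule.coe_add, add_assoc, hζ, x]
    abel

/-- Every `φ ∈ D(S^*)` is uniquely `φ = φ_* + G_* ζ_φ` with `φ_* ∈ D(A)` and `ζ_φ ∈ h`; this is
the linear bijection `φ ↦ (φ_*, ζ_φ)`. -/
def decomp : D.S.adjoint.domain ≃ₗ[ℂ] D.A.domain × h :=
  ((LinearEquiv.ofInjective D.decompMap D.decompMap_injective).trans
    (LinearEquiv.ofEq _ _ D.range_decompMap)).symm

theorem decomp_spec (φ : D.S.adjoint.domain) :
    (φ : H) = ((D.decomp φ).1 : H) + D.Gstar (D.decomp φ).2 := by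
  rw [← decompMap_apply]
  conv_lhs => rw [← D.decomp.symm_apply_apply φ]
  rfl

/-- `β̂₁ φ = ζ_φ`. -/
def β₁ : D.S.adjoint.domain →ₗ[ℂ] h :=
  LinearMap.snd ℂ D.A.domain h ∘ₗ D.decomp

/-- `β̂₂ φ = τ φ_*`. -/
def β₂ : D.S.adjoint.domain →ₗ[ℂ] h :=
  D.τ ∘ₗ LinearMap.fst ℂ D.A.domain h ∘ₗ D.decomp

/-- The subspace `{φ ∈ D(S^*) : β̂₁ φ ∈ D(Θ), Θ β̂₁ φ = Π β̂₂ φ}` of `H`. -/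
def boundarySubspace (p : ProjOpPair h) : Submodule ℂ H where
  carrier := {φ | ∃ (hφ : φ ∈ D.S.adjoint.domain) (x : p.op.domain),
    ((x : LinearMap.range (p.proj : h →ₗ[ℂ] h)) : h) = D.β₁ ⟨φ, hφ⟩ ∧
      (p.op x : h) = p.proj (D.β₂ ⟨φ, hφ⟩)}
  zero_mem' := ((p.relation.comap (D.β₁.prod D.β₂)).map D.S.adjoint.domain.subtype).zero_mem
    |> fun ⟨y, hy, h0⟩ => h0 ▸ ⟨y.2, hy⟩
  add_mem' := by
    rintro a b ⟨ha, hx⟩ ⟨hb, hy⟩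
    exact ⟨add_mem ha hb,
      (p.relation.comap (D.β₁.prod D.β₂)).add_mem (x := ⟨a, ha⟩) (y := ⟨b, hb⟩) hx hy⟩
  smul_mem' := by
    rintro c a ⟨ha, hx⟩
    exact ⟨Submodule.smul_mem _ c ha,
      (p.relation.comap (D.β₁.prod D.β₂)).smul_mem (x := ⟨a, ha⟩) c hx⟩

end TraceData

end SelfAdjExt

end

namespace SelfAdjExt

/-! ### Self-adjoint relations and their operator parts. -/

section Relations

variable {h : Type*} [NormedAddCommGroup h] [InnerProductSpace ℂ h]

/-! Part 1. Take `Π` to be the projection onto the closure `R` of the domain of `Λ`. Membership in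
`Λ = Λ^*` tests the second entry only against the domain, so replacing `y` by `Π y` does not affect
whether `(x, y) ∈ Λ` (`mem_iff_domainProj`). A vector `y ∈ R` with `(0, y) ∈ Λ` is orthogonal to
`R`, hence zero. So `Λ ∩ (R × R)` is the graph of an operator `Θ`, densely defined in `R`, and
self-adjointness of `Λ` passes to `Θ`.

Part 2. The maps `β̂₁`, `β̂₂` form a boundary triple for `S^*`: they satisfy Green's identity
(`green`), are jointly onto `h × h`, and vanish jointly only on `D(S)`. A self-adjoint `B ⊇ S`
satisfies `B ⊆ S^*`, and its domain is the preimage of the relation formed by its boundary values.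
Green's identity turns `B = B^*` into self-adjointness of that relation, and Part 1 supplies `(Π,
Θ)`. -/

theorem isSelfAdjoint_of_graph_adjoint_eq [CompleteSpace h] {T : h →ₗ.[ℂ] h}
    (hd : Dense (T.domain : Set h)) (hT : T.graph.adjoint = T.graph) : IsSelfAdjoint T := by
  refine LinearPMap.isSelfAdjoint_def.mpr (LinearPMap.eq_of_eq_graph ?_)
  rw [LinearPMap.adjoint_graph_eq_graph_adjoint hd, hT]

theorem IsSelfAdjointRelation.mem_iff [CompleteSpace h] {Λ : Submodule ℂ (h × h)}
    (hΛ : IsSelfAdjointRelation Λ) {x y : h} :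
    (x, y) ∈ Λ ↔ ∀ a b, (a, b) ∈ Λ → inner ℂ b x = inner ℂ a y := by
  conv_lhs => rw [← show Λ.adjoint = Λ from hΛ]
  simp only [Submodule.mem_adjoint_iff, sub_eq_zero]

/-- The part of a relation that lies in a subspace, as a relation in that subspace. -/
def relationRestrict (Λ : Submodule ℂ (h × h)) (R : Submodule ℂ h) : Submodule ℂ (R × R) :=
  Λ.comap (R.subtype.prodMap R.subtype)

theorem mem_relationRestrict {Λ : Submodule ℂ (h × h)} {R : Submodule ℂ h} {x : R × R} :
    x ∈ relationRestrict Λ R ↔ ((x.1 : h), (x.2 : h)) ∈ Λ := Iff.rfl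

variable [CompleteSpace h]

/-- The orthogonal projection onto the closure of the domain of a relation. -/
noncomputable def domainProj (Λ : Submodule ℂ (h × h)) : h →L[ℂ] h :=
  (Λ.map (LinearMap.fst ℂ h h)).topologicalClosure.starProjection

variable {Λ : Submodule ℂ (h × h)}

theorem isStarProjection_domainProj : IsStarProjection (domainProj Λ) :=
  isStarProjection_starProjection

theorem range_domainProj :
    LinearMap.range (domainProj Λ : h →ₗ[ℂ] h) =
      (Λ.map (LinearMap.fst ℂ h h)).topologicalClosure :=
  Submodule.range_starProjection _

theorem fst_mem_range_domainProj {x y : h} (hxy : (x, y) ∈ Λ) :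
    x ∈ LinearMap.range (domainProj Λ : h →ₗ[ℂ] h) := by
  rw [range_domainProj]
  exact Submodule.le_topologicalClosure _ ⟨_, hxy, rfl⟩

theorem inner_domainProj {x y z : h} (hxy : (x, y) ∈ Λ) :
    inner ℂ x (domainProj Λ z) = inner ℂ x z := by
  have hx := fst_mem_range_domainProj hxy
  rw [range_domainProj] at hx
  rw [domainProj, ← Submodule.inner_starProjection_left_eq_right,
    Submodule.starProjection_eq_self_iff.mpr hx]

/-- The second entry enters the criterion `mem_iff` only through inner products with domain
elements, which `Π` fixes. -/
theorem IsSelfAdjointRelation.mem_iff_domainProj (hΛ : IsSelfAdjointRelation Λ) {x y : h} :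
    (x, domainProj Λ y) ∈ Λ ↔ (x, y) ∈ Λ := by
  rw [hΛ.mem_iff, hΛ.mem_iff]
  exact forall₃_congr fun a b hab => by rw [inner_domainProj hab]

/-- Testing `(0, y)` against `Λ` gives `y ⟂ a` for all `a` in the domain, so `y` lies in both `R`
and `Rᗮ`. This makes the operator part single-valued. -/
theorem IsSelfAdjointRelation.eq_zero_of_mem (hΛ : IsSelfAdjointRelation Λ) {y : h}
    (hy : y ∈ LinearMap.range (domainProj Λ : h →ₗ[ℂ] h)) (h0 : ((0 : h), y) ∈ Λ) : y = 0 := by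
  rw [range_domainProj] at hy
  have hy' : y ∈ (Λ.map (LinearMap.fst ℂ h h)).topologicalClosureᗮ := by
    rw [Submodule.orthogonal_closure]
    rintro _ ⟨⟨a, b⟩, hab, rfl⟩
    simpa using (hΛ.mem_iff.mp h0 a b hab).symm
  exact inner_self_eq_zero.mp (Submodule.inner_right_of_mem_orthogonal (𝕜 := ℂ) hy hy')

/-- The operator part of a relation. -/
noncomputable def operatorPart (Λ : Submodule ℂ (h × h)) :
    LinearMap.range (domainProj Λ : h →ₗ[ℂ] h) →ₗ.[ℂ]
      LinearMap.range (domainProj Λ : h →ₗ[ℂ] h) :=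
  (relationRestrict Λ _).toLinearPMap

theorem IsSelfAdjointRelation.graph_operatorPart (hΛ : IsSelfAdjointRelation Λ) :
    (operatorPart Λ).graph = relationRestrict Λ _ := by
  refine Submodule.toLinearPMap_graph_eq _ ?_
  rintro ⟨x, y⟩ hxy h0
  refine Subtype.ext (hΛ.eq_zero_of_mem y.2 ?_)
  rw [mem_relationRestrict] at hxy
  simpa [show x = 0 from h0] using hxy

theorem IsSelfAdjointRelation.mem_domain_operatorPart (hΛ : IsSelfAdjointRelation Λ)
    {x : LinearMap.range (domainProj Λ : h →ₗ[ℂ] h)} :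
    x ∈ (operatorPart Λ).domain ↔ (x : h) ∈ Λ.map (LinearMap.fst ℂ h h) := by
  rw [LinearPMap.mem_domain_iff, hΛ.graph_operatorPart]
  constructor
  · rintro ⟨y, hy⟩
    exact ⟨_, hy, rfl⟩
  · rintro ⟨⟨a, b⟩, hab, rfl : a = (x : h)⟩
    -- A value `b` outside `R` may be replaced by `Π b`, so no domain element is lost.
    exact ⟨⟨domainProj Λ b, b, rfl⟩, hΛ.mem_iff_domainProj.mpr hab⟩

theorem IsSelfAdjointRelation.dense_domain_operatorPart (hΛ : IsSelfAdjointRelation Λ) :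
    Dense ((operatorPart Λ).domain :
      Set (LinearMap.range (domainProj Λ : h →ₗ[ℂ] h))) := by
  intro x
  have hx : (x : h) ∈ (Λ.map (LinearMap.fst ℂ h h)).topologicalClosure :=
    range_domainProj (Λ := Λ) ▸ x.2
  rw [closure_subtype]
  refine closure_mono ?_ hx
  rintro _ ⟨⟨a, b⟩, hab, rfl⟩
  exact ⟨⟨a, fst_mem_range_domainProj hab⟩,
    hΛ.mem_domain_operatorPart.mpr ⟨_, hab, rfl⟩, rfl⟩

/-- The adjoint inside `R` tests against fewer pairs than `Λ^*` does, but nothing is lost: each `(a,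
b) ∈ Λ` yields the test pair `(a, Π b)`, and `⟪Π b, x⟫ = ⟪b, x⟫` for `x ∈ R`. -/
theorem IsSelfAdjointRelation.adjoint_relationRestrict (hΛ : IsSelfAdjointRelation Λ) :
    (relationRestrict Λ (LinearMap.range (domainProj Λ : h →ₗ[ℂ] h))).adjoint =
      relationRestrict Λ _ := by
  ext ⟨x, y⟩
  rw [Submodule.mem_adjoint_iff, mem_relationRestrict, hΛ.mem_iff]
  constructor
  · intro hxy a b hab
    have := hxy ⟨a, fst_mem_range_domainProj hab⟩ ⟨domainProj Λ b, b, rfl⟩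
      (hΛ.mem_iff_domainProj.mpr hab)
    rw [sub_eq_zero, Submodule.coe_inner, Submodule.coe_inner] at this
    rw [← this]
    have hx : domainProj Λ (x : h) = x :=
      Submodule.starProjection_eq_self_iff.mpr (range_domainProj (Λ := Λ) ▸ x.2)
    conv_lhs => rw [← hx]
    exact (Submodule.inner_starProjection_left_eq_right _ _ _).symm
  · intro hxy a b hab
    exact sub_eq_zero.mpr (hxy a b hab)

theorem IsSelfAdjointRelation.isSelfAdjoint_operatorPart (hΛ : IsSelfAdjointRelation Λ) :
    haveI := completeSpace_range (isStarProjection_domainProj (Λ := Λ))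
    IsSelfAdjoint (operatorPart Λ) := by
  have := completeSpace_range (isStarProjection_domainProj (Λ := Λ))
  refine isSelfAdjoint_of_graph_adjoint_eq hΛ.dense_domain_operatorPart ?_
  rw [hΛ.graph_operatorPart, hΛ.adjoint_relationRestrict]

/-- A self-adjoint relation is given by the projection onto the closure of its domain and its
operator part. -/
theorem IsSelfAdjointRelation.exists_eq_relation (hΛ : IsSelfAdjointRelation Λ) :
    ∃ p : ProjOpPair h, Λ = p.relation := by
  refine ⟨⟨domainProj Λ, isStarProjection_domainProj, operatorPart Λ,
    hΛ.isSelfAdjoint_operatorPart⟩, ?_⟩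
  ext ⟨x, y⟩
  constructor
  · intro hxy
    have hmem : ((⟨x, fst_mem_range_domainProj hxy⟩, ⟨domainProj Λ y, y, rfl⟩) :
        LinearMap.range (domainProj Λ : h →ₗ[ℂ] h) × LinearMap.range (domainProj Λ : h →ₗ[ℂ] h))
        ∈ (operatorPart Λ).graph := by
      rw [hΛ.graph_operatorPart]
      exact hΛ.mem_iff_domainProj.mpr hxy
    obtain ⟨u, hu1, hu2⟩ := (LinearPMap.mem_graph_iff _).mp hmem
    exact ⟨u, congrArg Subtype.val hu1, congrArg Subtype.val hu2⟩
  · rintro ⟨u, hu1, hu2⟩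
    have hmem := (operatorPart Λ).mem_graph u
    rw [hΛ.graph_operatorPart, mem_relationRestrict] at hmem
    refine hΛ.mem_iff_domainProj.mp ?_
    have hu1' : ((u : LinearMap.range (domainProj Λ : h →ₗ[ℂ] h)) : h) = x := hu1
    have hu2' : (operatorPart Λ u : h) = domainProj Λ y := hu2
    rwa [hu1', hu2'] at hmem

end Relations

/-! ### Green's identity and the boundary maps. -/

namespace TraceData

variable {H h : Type*} [NormedAddCommGroup H] [InnerProductSpace ℂ H] [CompleteSpace H]
  [NormedAddCommGroup h] [InnerProductSpace ℂ h] [CompleteSpace h] (D : TraceData H h)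

/-- `S^*` acts on the range of `G(±i)` as multiplication by `±i`; averaging gives the formula. -/
theorem adjoint_Gstar (ζ : h) :
    ∃ x : D.S.adjoint.domain, (x : H) = D.Gstar ζ ∧
      D.S.adjoint x = (Complex.I / 2) • (D.G I_im_ne ζ - D.G neg_I_im_ne ζ) := by
  obtain ⟨x, hx1, hx2⟩ := D.adjoint_G I_im_ne ζ
  obtain ⟨y, hy1, hy2⟩ := D.adjoint_G neg_I_im_ne ζ
  refine ⟨(2⁻¹ : ℂ) • (y + x), ?_, ?_⟩
  · simp [Gstar, hx1, hy1]
  · rw [LinearPMap.map_smul, LinearPMap.map_add, hx2, hy2]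
    module

/-- The action of `S^*` in terms of the decomposition `φ = φ_* + G_* ζ_φ`. -/
theorem adjoint_apply (φ : D.S.adjoint.domain) :
    D.S.adjoint φ = D.A (D.decomp φ).1 +
      (Complex.I / 2) • (D.G I_im_ne (D.β₁ φ) - D.G neg_I_im_ne (D.β₁ φ)) := by
  obtain ⟨x, hx1, hx2⟩ := D.adjoint_A (D.decomp φ).1
  obtain ⟨y, hy1, hy2⟩ := D.adjoint_Gstar (D.β₁ φ)
  rw [← hx2, ← hy2, ← LinearPMap.map_add]
  congr 1
  refine Subtype.ext ?_
  rw [D.decomp_spec φ, Submodule.coe_add, hx1, hy1]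
  rfl

/-- The average of `inner_G'` at `z = ±i`. In view of `adjoint_Gstar`, it is Green's identity for a
pair from the range of `G_*` and `D(A)`. -/
theorem inner_Gstar_A (ζ : h) (φ : D.A.domain) :
    inner ℂ (D.Gstar ζ) (D.A φ) =
      inner ℂ ((Complex.I / 2) • (D.G I_im_ne ζ - D.G neg_I_im_ne ζ)) (φ : H) -
        inner ℂ ζ (D.τ φ) := by
  simp only [Gstar, smul_apply, add_apply, inner_smul_left, inner_add_left, inner_sub_left,
    inner_G', map_inv₀, map_div₀, map_neg, Complex.conj_I, Complex.conj_ofNat]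
  ring

theorem inner_A_Gstar (φ : D.A.domain) (ζ : h) :
    inner ℂ (D.A φ) (D.Gstar ζ) =
      inner ℂ (φ : H) ((Complex.I / 2) • (D.G I_im_ne ζ - D.G neg_I_im_ne ζ)) -
        inner ℂ (D.τ φ) ζ := by
  rw [← inner_conj_symm, inner_Gstar_A, map_sub, inner_conj_symm, inner_conj_symm]

/-- On `D(A)` the operators `A` and `S^*` agree, and `S^*` is known on each of the two terms. -/
theorem A_G_diff (ζ : h) :
    D.A ⟨_, D.G_diff_mem ζ⟩ = Complex.I • (D.G I_im_ne ζ + D.G neg_I_im_ne ζ) := by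
  obtain ⟨x, hx1, hx2⟩ := D.adjoint_G I_im_ne ζ
  obtain ⟨y, hy1, hy2⟩ := D.adjoint_G neg_I_im_ne ζ
  obtain ⟨w, hw1, hw2⟩ := D.adjoint_A ⟨_, D.G_diff_mem ζ⟩
  have hw : w = x - y := Subtype.ext (by rw [hw1, Submodule.coe_sub, hx1, hy1])
  rw [← hw2, hw, LinearPMap.map_sub, hx2, hy2]
  module

/-- The restriction of `S^*` to the range of `G_*` is symmetric. -/
theorem inner_Gstar_symm (ζ ξ : h) :
    inner ℂ ((Complex.I / 2) • (D.G I_im_ne ζ - D.G neg_I_im_ne ζ)) (D.Gstar ξ) =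
      inner ℂ (D.Gstar ζ) ((Complex.I / 2) • (D.G I_im_ne ξ - D.G neg_I_im_ne ξ)) := by
  -- Since `A (G(i)ζ - G(-i)ζ) = 2i G_* ζ`, symmetry of `A` on such differences is the claim up to a
  -- factor: one `1/2` comes from `G_*`, another from `i/2`.
  have key := D.formalAdjoint_A ⟨_, D.G_diff_mem ζ⟩ ⟨_, D.G_diff_mem ξ⟩
  rw [A_G_diff, A_G_diff] at key
  simp only [Gstar, smul_apply, add_apply, inner_smul_left, inner_smul_right, inner_add_left,
    inner_add_right, inner_sub_left, inner_sub_right, map_inv₀, map_div₀, Complex.conj_I,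
    Complex.conj_ofNat] at key ⊢
  linear_combination (1 / 4 : ℂ) * key

/-- Green's identity for the boundary maps `β̂₁`, `β̂₂`. -/
theorem green (φ ψ : D.S.adjoint.domain) :
    inner ℂ (D.S.adjoint φ) (ψ : H) - inner ℂ (φ : H) (D.S.adjoint ψ) =
      inner ℂ (D.β₁ φ) (D.β₂ ψ) - inner ℂ (D.β₂ φ) (D.β₁ ψ) := by
  have h1 := D.formalAdjoint_A (D.decomp φ).1 (D.decomp ψ).1
  have h2 := D.inner_Gstar_A (D.β₁ φ) (D.decomp ψ).1
  have h3 := D.inner_A_Gstar (D.decomp φ).1 (D.β₁ ψ)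
  have h4 := D.inner_Gstar_symm (D.β₁ φ) (D.β₁ ψ)
  have hφ : (φ : H) = ((D.decomp φ).1 : H) + D.Gstar (D.β₁ φ) := D.decomp_spec φ
  have hψ : (ψ : H) = ((D.decomp ψ).1 : H) + D.Gstar (D.β₁ ψ) := D.decomp_spec ψ
  have hβφ : D.β₂ φ = D.τ (D.decomp φ).1 := rfl
  have hβψ : D.β₂ ψ = D.τ (D.decomp ψ).1 := rfl
  rw [adjoint_apply, adjoint_apply, hφ, hψ, hβφ, hβψ, inner_add_left, inner_add_left,
    inner_add_right, inner_add_right, inner_add_right, inner_add_right]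
  -- The `A`–`A` and `G_*`–`G_*` pairings cancel; only the two mixed ones leave boundary terms.
  linear_combination h1 - h2 + h3 + h4

theorem exists_boundary_values (ζ₁ ζ₂ : h) :
    ∃ φ : D.S.adjoint.domain, D.β₁ φ = ζ₁ ∧ D.β₂ φ = ζ₂ := by
  obtain ⟨u, hu⟩ := D.surjective ζ₂
  exact ⟨D.decomp.symm (u, ζ₁), by simp [β₁], by simp [β₂, hu]⟩

theorem mem_S_of_boundary_values_eq_zero {φ : D.S.adjoint.domain} (h1 : D.β₁ φ = 0)
    (h2 : D.β₂ φ = 0) : (φ : H) ∈ D.S.domain := by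
  obtain ⟨y, hy, -⟩ := D.mem_S (φ := (D.decomp φ).1) h2
  have hφ : (φ : H) = ((D.decomp φ).1 : H) + D.Gstar (D.β₁ φ) := D.decomp_spec φ
  rw [hφ, h1, map_zero, add_zero, ← hy]
  exact y.2

/-! ### Self-adjoint extensions and their boundary relations. -/

/-- The relation formed by the boundary values of the elements of `D(B)`. -/
noncomputable def boundaryRelation (B : H →ₗ.[ℂ] H) : Submodule ℂ (h × h) :=
  (B.domain.comap D.S.adjoint.domain.subtype).map (D.β₁.prod D.β₂)

variable {D} {B : H →ₗ.[ℂ] H}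

theorem mem_boundaryRelation {ζ : h × h} : ζ ∈ D.boundaryRelation B ↔
    ∃ φ : D.S.adjoint.domain, (φ : H) ∈ B.domain ∧ D.β₁ φ = ζ.1 ∧ D.β₂ φ = ζ.2 := by
  simp only [boundaryRelation, Submodule.mem_map, Submodule.mem_comap, Prod.ext_iff]
  rfl

/-- Two elements of `D(S^*)` with equal boundary values differ by an element of `D(S) ⊆ D(B)`, so
boundary values alone decide membership in `D(B)`. -/
theorem boundary_mem_boundaryRelation_iff (hSB : D.S ≤ B) (φ : D.S.adjoint.domain) :
    (D.β₁ φ, D.β₂ φ) ∈ D.boundaryRelation B ↔ (φ : H) ∈ B.domain := by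
  refine ⟨fun hm => ?_, fun hφ => mem_boundaryRelation.mpr ⟨φ, hφ, rfl, rfl⟩⟩
  obtain ⟨χ, hχ, h1, h2⟩ := mem_boundaryRelation.mp hm
  have hs : ((φ - χ : D.S.adjoint.domain) : H) ∈ D.S.domain :=
    D.mem_S_of_boundary_values_eq_zero (by rw [map_sub, h1, sub_self])
      (by rw [map_sub, h2, sub_self])
  have := add_mem (hSB.1 hs) hχ
  rwa [Submodule.coe_sub, sub_add_cancel] at this

theorem isFormalAdjoint_of_isSelfAdjoint (hB : IsSelfAdjoint B) : B.IsFormalAdjoint B := by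
  have := LinearPMap.adjoint_isFormalAdjoint hB.dense_domain
  rwa [LinearPMap.isSelfAdjoint_def.mp hB] at this

/-- Adjoints reverse inclusions: `B = B^* ⊆ S^*`. -/
theorem le_adjoint_S (hB : IsSelfAdjoint B) (hSB : D.S ≤ B) : B ≤ D.S.adjoint := by
  refine LinearPMap.IsFormalAdjoint.le_adjoint D.dense_S fun y φ => ?_
  rw [hSB.2 (y := ⟨y, hSB.1 y.2⟩) rfl]
  exact isFormalAdjoint_of_isSelfAdjoint hB ⟨y, hSB.1 y.2⟩ φ

theorem isSelfAdjointRelation_boundaryRelation (hB : IsSelfAdjoint B) (hSB : D.S ≤ B) :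
    IsSelfAdjointRelation (D.boundaryRelation B) := by
  have hle := le_adjoint_S hB hSB
  have hBS : ∀ (φ : D.S.adjoint.domain) (hφ : (φ : H) ∈ B.domain),
      B ⟨φ, hφ⟩ = D.S.adjoint φ := fun φ hφ => hle.2 rfl
  ext ⟨ξ₁, ξ₂⟩
  -- Every pair in `h × h` is the pair of boundary values of some `φ`, so both sides become
  -- conditions on `φ`.
  obtain ⟨φ, rfl, rfl⟩ := D.exists_boundary_values ξ₁ ξ₂
  rw [boundary_mem_boundaryRelation_iff hSB, Submodule.mem_adjoint_iff]
  constructor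
  · intro hφ
    rw [← LinearPMap.isSelfAdjoint_def.mp hB]
    -- The adjoint relation makes the boundary form of `φ` with every `χ ∈ D(B)` vanish; by Green's
    -- identity `φ ∈ D(B^*)`, with value `S^* φ`.
    refine LinearPMap.mem_adjoint_domain_of_exists _ ⟨D.S.adjoint φ, fun χ => ?_⟩
    have hg := D.green ⟨χ, hle.1 χ.2⟩ φ
    have := hφ _ _ ((boundary_mem_boundaryRelation_iff hSB ⟨χ, hle.1 χ.2⟩).mpr χ.2)
    rw [← hBS ⟨χ, hle.1 χ.2⟩ χ.2] at hg
    have h0 : inner ℂ (B χ) (φ : H) = inner ℂ (χ : H) (D.S.adjoint φ) := by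
      linear_combination hg - this
    rw [← inner_conj_symm, ← h0, inner_conj_symm]
  · intro hφ a b hab
    obtain ⟨χ, hχ, h1, h2⟩ := mem_boundaryRelation.mp hab
    obtain rfl : D.β₁ χ = a := h1
    obtain rfl : D.β₂ χ = b := h2
    have hg := D.green χ φ
    rw [← hBS χ hχ, ← hBS φ hφ] at hg
    -- Conversely, symmetry of `B` kills the left side of Green's identity.
    have := isFormalAdjoint_of_isSelfAdjoint hB ⟨χ, hχ⟩ ⟨φ, hφ⟩
    linear_combination hg - this

theorem mem_boundarySubspace {p : ProjOpPair h} {φ : H} :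
    φ ∈ D.boundarySubspace p ↔
      ∃ hφ : φ ∈ D.S.adjoint.domain, (D.β₁ ⟨φ, hφ⟩, D.β₂ ⟨φ, hφ⟩) ∈ p.relation :=
  Iff.rfl

/-- Every self-adjoint extension of `S` is a restriction of `S^*` by a boundary condition. -/
theorem exists_eq_domRestrict (hB : IsSelfAdjoint B) (hSB : D.S ≤ B) :
    ∃ p : ProjOpPair h, B = D.S.adjoint.domRestrict (D.boundarySubspace p) := by
  have hle := le_adjoint_S hB hSB
  obtain ⟨p, hp⟩ := (isSelfAdjointRelation_boundaryRelation hB hSB).exists_eq_relation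
  have hdom : ∀ φ, φ ∈ D.boundarySubspace p ↔ φ ∈ B.domain := by
    intro φ
    rw [mem_boundarySubspace, ← hp]
    constructor
    · rintro ⟨hφ, hm⟩
      exact (boundary_mem_boundaryRelation_iff hSB ⟨φ, hφ⟩).mp hm
    · intro hφ
      exact ⟨hle.1 hφ, (boundary_mem_boundaryRelation_iff hSB ⟨φ, hle.1 hφ⟩).mpr hφ⟩
  refine ⟨p, LinearPMap.eq_of_le_of_domain_eq ⟨?_, ?_⟩ ?_⟩
  · exact fun φ hφ => ⟨(hdom φ).mpr hφ, hle.1 hφ⟩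
  · intro x y hxy
    rw [hle.2 (y := ⟨y, y.2.2⟩) hxy]
    exact (LinearPMap.domRestrict_apply rfl).symm
  · ext φ
    exact ⟨fun hφ => ⟨(hdom φ).mpr hφ, hle.1 hφ⟩, fun hφ => (hdom φ).mp hφ.1⟩

end TraceData

end SelfAdjExt

theorem theorem4p3 {H h : Type*} [NormedAddCommGroup H] [InnerProductSpace ℂ H] [CompleteSpace H]
    [NormedAddCommGroup h] [InnerProductSpace ℂ h] [CompleteSpace h] :
    (∀ Λ : Submodule ℂ (h × h), SelfAdjExt.IsSelfAdjointRelation Λ →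
      ∃ p : SelfAdjExt.ProjOpPair h, Λ = p.relation) ∧
    (∀ D : SelfAdjExt.TraceData H h, ∀ B : H →ₗ.[ℂ] H, IsSelfAdjoint B → D.S ≤ B →
      ∃ p : SelfAdjExt.ProjOpPair h,
        B = D.S.adjoint.domRestrict (D.boundarySubspace p)) :=
  ⟨fun _ hΛ => hΛ.exists_eq_relation,
    fun _ _ hB hSB => SelfAdjExt.TraceData.exists_eq_domRestrict hB hSB⟩
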